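/- Let $\theta>0$ and let $Y_1,Y_2,\dots$ be independent random variables, each distributed as $U^{1/\theta}$ with $U$ uniform on $[0,1]$. Put $X_i=Y_1Y_2\cdots Y_i$ for $i\ge 1$, let $\tau=(1+\sqrt5)/2$, and define the random set $$\widetilde S^\theta=\Big\{\sum_{i=1}^\infty a_iX_i:\ a_i\in\{0,1\},\ a_ia_{i+1}=0\ \text{for all } i\ge1\Big\}\subset\mathbb R .$$ (a) If $\theta>1/\log\tau$, then almost surely $\widetilde S^\theta$ has positive Lebesgue measure. (b) If $0<\theta<1/\log\tau$, then almost surely $\widetilde S^\theta$ has Lebesgue measure zero and Hausdorff dimension $\theta\log\tau$. -/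

import Mathlib

open MeasureTheory
open ProbabilityTheory (HasLaw iIndepFun)

/-- The distribution of `U ^ (1 / θ)`, where `U` is uniformly distributed on `[0, 1]`. -/
noncomputable def powerUniformLaw (θ : ℝ) : Measure ℝ :=
  (volume.restrict (Set.Icc (0 : ℝ) 1)).map (fun u : ℝ => u ^ (1 / θ))

/-- The partial products `X_{i+1} = y_1 ⋯ y_{i+1}`; the sequence `y_1, y_2, …` is indexed
here as `y 0, y 1, …`, so that the first term is `y 0`. -/
noncomputable def partialProd (y : ℕ → ℝ) (i : ℕ) : ℝ :=
  ∏ j ∈ Finset.range (i + 1), y j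

/-- The set of the sums `∑ a_i X_i`, over all digit sequences `a_i ∈ {0, 1}`
with `a_i a_{i+1} = 0` for all `i`. -/
def fibonacciSumSet (y : ℕ → ℝ) : Set ℝ :=
  {z : ℝ | ∃ a : ℕ → ℝ, (∀ i, a i = 0 ∨ a i = 1) ∧ (∀ i, a i * a (i + 1) = 0) ∧
    HasSum (fun i => a i * partialProd y i) z}

/-! Write φ for the golden ratio. By the law of large numbers, X_n = exp(-n/θ + o(n)) almost surely,
while there are about φ^n admissible words of length n. Covering by one interval per word, of the
length of the tail sum, gives `μH[d] = 0` for every d > θ log φ. This is the upper bound on the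
dimension and, with d = 1, nullity (`IsTypical.hausdorffMeasure_fibonacciSumSet`).

For the lower bounds, push Lebesgue measure on [0,1) to the set by x ↦ ∑ a_i(x) X_i, with a(x) the
greedy digits of x in base φ. If the digits of x and x' first differ at N, then |x - x'| ≤ φ^(-N),
and the two sums differ by `partialProd y N` times ±1 + y_{N+1} v, where v is independent of
y_{N+1}. The law of y_{N+1} puts this factor in [-ρ, ρ] with probability O(ρ), uniformly in v. On
the event that the products are at least exp(-γ(n+1))/M, with γ > 1/θ, the sums are within r of each
other with probability O(r^s |x - x'|^(-γs/log φ)), for any 0 < s ≤ 1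
(`powerUniformSeqLaw_restrict_abs_digitSum_sub_le`). The kernel is integrable when γs < log φ. If θ
log φ > 1, s = 1 is allowed: the image measure has finite lower density almost everywhere, hence is
absolutely continuous. If θ log φ < 1, every s < θ log φ is allowed, and the mass distribution
principle gives dimension at least s. -/

/-! ### Greedy expansions in base the golden ratio -/

/-- The orbit of the fractional part of `x` under `t ↦ fract (φ t)`. -/
noncomputable def goldenOrbit (x : ℝ) : ℕ → ℝ
  | 0 => Int.fract x
  | n + 1 => Int.fract (Real.goldenRatio * goldenOrbit x n)

/-- The digits of the greedy expansion of `fract x` in base the golden ratio. -/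
noncomputable def goldenDigit (x : ℝ) (n : ℕ) : ℝ :=
  (⌊Real.goldenRatio * goldenOrbit x n⌋ : ℤ)

theorem goldenOrbit_nonneg (x : ℝ) (n : ℕ) : 0 ≤ goldenOrbit x n := by
  cases n <;> exact Int.fract_nonneg _

theorem goldenOrbit_lt_one (x : ℝ) (n : ℕ) : goldenOrbit x n < 1 := by
  cases n <;> exact Int.fract_lt_one _

theorem goldenOrbit_succ (x : ℝ) (n : ℕ) :
    goldenOrbit x (n + 1) = Real.goldenRatio * goldenOrbit x n - goldenDigit x n := by
  rw [goldenOrbit, goldenDigit, Int.fract]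

theorem goldenDigit_eq_zero_or_one (x : ℝ) (n : ℕ) : goldenDigit x n = 0 ∨ goldenDigit x n = 1 := by
  have h0 : 0 ≤ ⌊Real.goldenRatio * goldenOrbit x n⌋ :=
    Int.floor_nonneg.2 (mul_nonneg Real.goldenRatio_pos.le (goldenOrbit_nonneg x n))
  have h2 : ⌊Real.goldenRatio * goldenOrbit x n⌋ < 2 := by
    rw [Int.floor_lt]
    push_cast
    nlinarith [goldenOrbit_nonneg x n, goldenOrbit_lt_one x n, Real.goldenRatio_lt_two,
      Real.goldenRatio_pos]
  unfold goldenDigit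
  rcases (show ⌊Real.goldenRatio * goldenOrbit x n⌋ = 0 ∨
    ⌊Real.goldenRatio * goldenOrbit x n⌋ = 1 by omega) with h | h <;> simp [h]

/-- After a digit 1 the orbit is below φ - 1 = 1/φ, so multiplying by φ keeps it below 1. -/
theorem goldenDigit_mul_succ (x : ℝ) (n : ℕ) : goldenDigit x n * goldenDigit x (n + 1) = 0 := by
  rcases goldenDigit_eq_zero_or_one x n with h | h
  · simp [h]
  · have hs := goldenOrbit_succ x n
    have hs' := goldenOrbit_succ x (n + 1)
    rw [h] at hs
    have hlt : goldenDigit x (n + 1) ≠ 1 := by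
      intro h1
      rw [h1] at hs'
      have := goldenOrbit_nonneg x (n + 2)
      rw [hs', hs] at this
      nlinarith [goldenOrbit_lt_one x n, Real.goldenRatio_sq, Real.goldenRatio_pos]
    rcases goldenDigit_eq_zero_or_one x (n + 1) with h' | h'
    · simp [h']
    · exact absurd h' hlt

/-- As long as digits agree, both orbits move under the same affine map of slope φ. -/
theorem goldenOrbit_sub_of_digits_eq {x x' : ℝ} {N : ℕ}
    (h : ∀ i < N, goldenDigit x i = goldenDigit x' i) :
    goldenOrbit x N - goldenOrbit x' N =
      Real.goldenRatio ^ N * (Int.fract x - Int.fract x') := by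
  induction N with
  | zero => simp [goldenOrbit]
  | succ N ih =>
    rw [goldenOrbit_succ, goldenOrbit_succ, h N N.lt_succ_self, pow_succ',
      mul_assoc, ← ih fun i hi => h i (hi.trans N.lt_succ_self)]
    ring

theorem goldenRatio_pow_mul_abs_le {x x' : ℝ} {N : ℕ}
    (h : ∀ i < N, goldenDigit x i = goldenDigit x' i) :
    Real.goldenRatio ^ N * |Int.fract x - Int.fract x'| ≤ 1 := by
  have hp : (0 : ℝ) < Real.goldenRatio ^ N := pow_pos Real.goldenRatio_pos N
  rw [← abs_of_pos hp, ← abs_mul, ← goldenOrbit_sub_of_digits_eq h, abs_le]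
  constructor <;> linarith [goldenOrbit_nonneg x N, goldenOrbit_lt_one x N,
    goldenOrbit_nonneg x' N, goldenOrbit_lt_one x' N]

theorem exists_goldenDigit_ne {x x' : ℝ} (h : Int.fract x ≠ Int.fract x') :
    ∃ n, goldenDigit x n ≠ goldenDigit x' n := by
  by_contra! H
  have hpos : 0 < |Int.fract x - Int.fract x'| := abs_pos.2 (sub_ne_zero.2 h)
  obtain ⟨n, hn⟩ := pow_unbounded_of_one_lt (|Int.fract x - Int.fract x'|⁻¹)
    Real.one_lt_goldenRatio
  have h1 := goldenRatio_pow_mul_abs_le (N := n) fun i _ => H i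
  rw [inv_lt_iff_one_lt_mul₀ hpos] at hn
  linarith

theorem measurable_goldenOrbit (n : ℕ) : Measurable fun x => goldenOrbit x n := by
  induction n with
  | zero => exact measurable_fract
  | succ n ih => exact measurable_fract.comp (ih.const_mul _)

theorem measurable_goldenDigit (n : ℕ) : Measurable fun x => goldenDigit x n := by
  unfold goldenDigit
  exact (measurable_from_top (f := fun k : ℤ => (k : ℝ))).comp
    (Int.measurable_floor.comp ((measurable_goldenOrbit n).const_mul _))

/-! ### Exponential decay of the partial products -/

/-- Sequences in `(0, 1]` whose logarithms have Cesàro mean `-1 / θ`. -/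
def IsTypical (θ : ℝ) (y : ℕ → ℝ) : Prop :=
  (∀ i, 0 < y i ∧ y i ≤ 1) ∧
    Filter.Tendsto (fun n : ℕ => (∑ i ∈ Finset.range n, Real.log (y i)) / n) Filter.atTop
      (nhds (-1 / θ))

theorem partialProd_pos {y : ℕ → ℝ} (hy : ∀ i, 0 < y i) (n : ℕ) : 0 < partialProd y n :=
  Finset.prod_pos fun i _ => hy i

theorem IsTypical.pos {θ : ℝ} {y : ℕ → ℝ} (hy : IsTypical θ y) (i : ℕ) : 0 < y i := (hy.1 i).1

theorem IsTypical.partialProd_pos {θ : ℝ} {y : ℕ → ℝ} (hy : IsTypical θ y) (n : ℕ) :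
    0 < partialProd y n := _root_.partialProd_pos hy.pos n

theorem IsTypical.tendsto_log_partialProd {θ : ℝ} {y : ℕ → ℝ} (hy : IsTypical θ y) :
    Filter.Tendsto (fun n : ℕ => Real.log (partialProd y n) / (n + 1 : ℝ)) Filter.atTop
      (nhds (-1 / θ)) := by
  have h := hy.2.comp (Filter.tendsto_add_atTop_nat 1)
  refine h.congr fun n => ?_
  simp only [Function.comp, partialProd]
  rw [Real.log_prod fun i _ => (hy.pos i).ne']
  push_cast
  rfl

theorem IsTypical.exists_partialProd_le {θ β : ℝ} {y : ℕ → ℝ} (hy : IsTypical θ y)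
    (hβ : β < 1 / θ) :
    ∃ C, 0 < C ∧ ∀ n : ℕ, partialProd y n ≤ C * Real.exp (-β * (n + 1)) := by
  have h1 : ∀ᶠ n : ℕ in Filter.atTop, partialProd y n * Real.exp (β * (n + 1)) ≤ 1 := by
    have := hy.tendsto_log_partialProd.eventually_lt_const (show -1 / θ < -β by
      rw [neg_div]; linarith)
    filter_upwards [this] with n hn
    rw [div_lt_iff₀ (by positivity)] at hn
    rw [← Real.exp_log (hy.partialProd_pos n), ← Real.exp_add, Real.exp_le_one_iff]
    linarith
  obtain ⟨C, hC⟩ := (Filter.isBoundedUnder_of_eventually_le h1).bddAbove_range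
  refine ⟨max C 1, by positivity, fun n => ?_⟩
  have := (hC ⟨n, rfl⟩).trans (le_max_left C 1)
  rw [neg_mul, Real.exp_neg, ← div_eq_mul_inv, le_div_iff₀ (Real.exp_pos _)]
  exact this

theorem IsTypical.exists_le_partialProd {θ γ : ℝ} {y : ℕ → ℝ} (hy : IsTypical θ y)
    (hγ : 1 / θ < γ) :
    ∃ C, 0 < C ∧ ∀ n : ℕ, Real.exp (-γ * (n + 1)) ≤ C * partialProd y n := by
  have h1 : ∀ᶠ n : ℕ in Filter.atTop, Real.exp (-γ * (n + 1)) / partialProd y n ≤ 1 := by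
    have := hy.tendsto_log_partialProd.eventually_const_lt (show -γ < -1 / θ by
      rw [neg_div]; linarith)
    filter_upwards [this] with n hn
    rw [lt_div_iff₀ (by positivity)] at hn
    rw [← Real.exp_log (hy.partialProd_pos n), ← Real.exp_sub, Real.exp_le_one_iff]
    linarith
  -- The finitely many exceptional indices are absorbed into the constant.
  obtain ⟨C, hC⟩ := (Filter.isBoundedUnder_of_eventually_le h1).bddAbove_range
  refine ⟨max C 1, by positivity, fun n => ?_⟩
  have := (hC ⟨n, rfl⟩).trans (le_max_left C 1)
  rwa [← div_le_iff₀ (hy.partialProd_pos n)]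

theorem summable_exp_neg_mul_succ {β : ℝ} (hβ : 0 < β) :
    Summable fun n : ℕ => Real.exp (-β * (n + 1)) := by
  have h := (Real.summable_exp_nat_mul_iff.2 (neg_neg_of_pos hβ)).mul_left (Real.exp (-β))
  refine h.congr fun n => ?_
  rw [← Real.exp_add]
  ring_nf

theorem IsTypical.summable_partialProd {θ : ℝ} (hθ : 0 < θ) {y : ℕ → ℝ} (hy : IsTypical θ y) :
    Summable (partialProd y) := by
  have hβ : 0 < 1 / θ := by positivity
  obtain ⟨C, hC, h⟩ := hy.exists_partialProd_le (half_lt_self hβ)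
  exact Summable.of_nonneg_of_le (fun n => (hy.partialProd_pos n).le) h
    ((summable_exp_neg_mul_succ (half_pos hβ)).mul_left C)

theorem IsTypical.exists_tail_le {θ β : ℝ} {y : ℕ → ℝ} (hy : IsTypical θ y)
    (hβ0 : 0 < β) (hβ : β < 1 / θ) :
    ∃ C, 0 < C ∧ ∀ n : ℕ, ∑' i, partialProd y (i + n) ≤ C * Real.exp (-β * n) := by
  obtain ⟨C, hC, h⟩ := hy.exists_partialProd_le hβ
  have hs := summable_exp_neg_mul_succ hβ0
  refine ⟨C * ∑' n : ℕ, Real.exp (-β * (n + 1)), mul_pos hC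
    (hs.tsum_pos (fun _ => (Real.exp_pos _).le) 0 (Real.exp_pos _)), fun n => ?_⟩
  have hle : ∀ i, partialProd y (i + n) ≤ C * Real.exp (-β * n) * Real.exp (-β * (i + 1)) := by
    intro i
    refine (h (i + n)).trans_eq ?_
    rw [mul_assoc, ← Real.exp_add]
    push_cast
    ring_nf
  have hs' := hs.mul_left (C * Real.exp (-β * n))
  refine ((Summable.of_nonneg_of_le (fun i => (hy.partialProd_pos _).le) hle hs').tsum_le_tsum
    hle hs').trans_eq ?_
  rw [tsum_mul_left]
  ring

/-! ### Upper bound by counting words -/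

/-- The sums of the first `n` terms over all digit words with no two consecutive ones. -/
noncomputable def fibonacciSumFinset (y : ℕ → ℝ) : ℕ → Finset ℝ
  | 0 => {0}
  | 1 => {0, partialProd y 0}
  | n + 2 => fibonacciSumFinset y (n + 1) ∪
      (fibonacciSumFinset y n).image (· + partialProd y (n + 1))

/-- The recursion splits on the last digit, a 1 forcing a 0 before it; φ^(n+1) satisfies the same
Fibonacci recursion. -/
theorem card_fibonacciSumFinset_le (y : ℕ → ℝ) (n : ℕ) :
    ((fibonacciSumFinset y n).card : ℝ) ≤ Real.goldenRatio ^ (n + 1) := by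
  induction n using Nat.twoStepInduction with
  | zero => simpa [fibonacciSumFinset] using Real.one_lt_goldenRatio.le
  | one =>
    have h : ((fibonacciSumFinset y 1).card : ℝ) ≤ 2 := by
      exact_mod_cast Finset.card_le_two
    have h2 := Real.goldenRatio_sq
    have h3 := Real.one_lt_goldenRatio
    norm_num
    linarith
  | more n h0 h1 =>
    have h : ((fibonacciSumFinset y (n + 2)).card : ℝ) ≤
        (fibonacciSumFinset y (n + 1)).card + (fibonacciSumFinset y n).card := by
      exact_mod_cast (Finset.card_union_le _ _).trans
        (add_le_add_right Finset.card_image_le _)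
    have h2 := Real.goldenRatio_pow_sub_goldenRatio_pow (n + 1)
    linarith

theorem sum_mem_fibonacciSumFinset (y a : ℕ → ℝ) (h01 : ∀ i, a i = 0 ∨ a i = 1)
    (hmul : ∀ i, a i * a (i + 1) = 0) (n : ℕ) :
    ∑ i ∈ Finset.range n, a i * partialProd y i ∈ fibonacciSumFinset y n := by
  induction n using Nat.twoStepInduction with
  | zero => simp [fibonacciSumFinset]
  | one => rcases h01 0 with h | h <;> simp [fibonacciSumFinset, h]
  | more n h0 h1 =>
    rw [fibonacciSumFinset, Finset.mem_union]
    rcases h01 (n + 1) with h | h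
    · left
      rw [Finset.sum_range_succ, h]
      simpa using h1
    · right
      have hn : a n = 0 := by simpa [h] using hmul n
      rw [Finset.sum_range_succ, Finset.sum_range_succ, h, hn, one_mul, zero_mul, add_zero]
      exact Finset.mem_image_of_mem _ h0

theorem IsTypical.hausdorffMeasure_fibonacciSumSet {θ d : ℝ} (hθ : 0 < θ) {y : ℕ → ℝ}
    (hy : IsTypical θ y) (hd : θ * Real.log Real.goldenRatio < d) :
    μH[d] (fibonacciSumSet y) = 0 := by
  have hlog : 0 < Real.log Real.goldenRatio := Real.log_pos Real.one_lt_goldenRatio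
  have hd0 : 0 < d := (mul_pos hθ hlog).trans hd
  -- β < 1/θ makes the tails O(exp(-βn)); βd > log φ makes φ^(n+1) exp(-βdn) tend to 0.
  obtain ⟨β, hβ1, hβ2⟩ : ∃ β, Real.log Real.goldenRatio / d < β ∧ β < 1 / θ :=
    exists_between (by rw [div_lt_div_iff₀ hd0 hθ]; linarith)
  have hβ0 : 0 < β := (div_pos hlog hd0).trans hβ1
  rw [div_lt_iff₀ hd0] at hβ1
  obtain ⟨C, hC, hR⟩ := hy.exists_tail_le hβ0 hβ2
  have hsum := hy.summable_partialProd hθ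
  have hexp : Filter.Tendsto (fun n : ℕ => C * Real.exp (-β * n)) Filter.atTop (nhds 0) := by
    have := (Real.summable_exp_nat_mul_iff.2 (neg_neg_of_pos hβ0)).tendsto_atTop_zero
    simpa [mul_comm] using this.const_mul C
  have key := Measure.hausdorffMeasure_le_liminf_sum (ι := fun n => fibonacciSumFinset y n) d
    (fibonacciSumSet y) (l := Filter.atTop)
    (fun n : ℕ => ENNReal.ofReal (C * Real.exp (-β * n)))
    (by simpa using ENNReal.tendsto_ofReal hexp)
    (fun n f => Set.Icc (f : ℝ) (f + C * Real.exp (-β * n)))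
    (Filter.Eventually.of_forall fun n f => by rw [Real.ediam_Icc]; simp)
    (Filter.Eventually.of_forall fun n z hz => by
      obtain ⟨a, h01, hmul, hz⟩ := hz
      refine Set.mem_iUnion.2 ⟨⟨_, sum_mem_fibonacciSumFinset y a h01 hmul n⟩, ?_⟩
      have hle : ∀ i, a i * partialProd y i ≤ partialProd y i := fun i => by
        rcases h01 i with h | h <;> simp [h, (hy.partialProd_pos i).le]
      have hnn : ∀ i, 0 ≤ a i * partialProd y i := fun i => by
        rcases h01 i with h | h <;> simp [h, (hy.partialProd_pos i).le]
      rw [← hz.tsum_eq, ← hz.summable.sum_add_tsum_nat_add n]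
      refine ⟨le_add_of_nonneg_right (tsum_nonneg fun i => hnn _), ?_⟩
      simp only [add_le_add_iff_left]
      exact (((summable_nat_add_iff n).2 hz.summable).tsum_le_tsum (fun i => hle _)
        ((summable_nat_add_iff n).2 hsum)).trans (hR n))
  refine le_antisymm (key.trans ?_) bot_le
  have hlim : Filter.Tendsto (fun n : ℕ => ENNReal.ofReal
      (Real.goldenRatio ^ (n + 1) * (C * Real.exp (-β * n)) ^ d)) Filter.atTop (nhds 0) := by
    rw [← ENNReal.ofReal_zero]
    refine ENNReal.tendsto_ofReal ?_
    have := (Real.summable_exp_nat_mul_iff.2 (sub_neg.2 hβ1)).tendsto_atTop_zero.const_mul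
      (Real.goldenRatio * C ^ d)
    rw [mul_zero] at this
    refine this.congr fun n => ?_
    rw [Real.mul_rpow hC.le (Real.exp_pos _).le, ← Real.exp_mul, pow_succ,
      ← Real.exp_log Real.goldenRatio_pos, ← Real.exp_nat_mul, Real.log_exp,
      show (n : ℝ) * (Real.log Real.goldenRatio - β * d) =
        n * Real.log Real.goldenRatio + -β * n * d by ring, Real.exp_add]
    ring
  refine (Filter.liminf_le_liminf (Filter.Eventually.of_forall fun n => ?_)).trans
    hlim.liminf_eq.le
  simp only [Real.ediam_Icc, add_sub_cancel_left, Finset.sum_const, Finset.univ_eq_attach,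
    Finset.card_attach, nsmul_eq_mul]
  rw [ENNReal.ofReal_rpow_of_pos (by positivity), ENNReal.ofReal_mul
    (pow_nonneg Real.goldenRatio_pos.le _), ← ENNReal.ofReal_natCast]
  gcongr
  exact card_fibonacciSumFinset_le y n

theorem IsTypical.dimH_fibonacciSumSet_le {θ : ℝ} (hθ : 0 < θ) {y : ℕ → ℝ}
    (hy : IsTypical θ y) :
    dimH (fibonacciSumSet y) ≤ ENNReal.ofReal (θ * Real.log Real.goldenRatio) := by
  refine ENNReal.le_of_forall_pos_le_add fun ε hε _ => ?_
  have h := hy.hausdorffMeasure_fibonacciSumSet hθ (lt_add_of_pos_right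
    (θ * Real.log Real.goldenRatio) (NNReal.coe_pos.2 hε))
  have hlog : 0 < Real.log Real.goldenRatio := Real.log_pos Real.one_lt_goldenRatio
  rw [← ENNReal.ofReal_coe_nnreal, ← ENNReal.ofReal_add (by positivity) ε.coe_nonneg]
  refine dimH_le_of_hausdorffMeasure_ne_top (d := Real.toNNReal _) ?_
  rw [Real.coe_toNNReal _ (by positivity), h]
  exact ENNReal.zero_ne_top

/-! ### The law of a single factor -/

theorem measurable_rpow_inv (θ : ℝ) : Measurable fun u : ℝ => u ^ (1 / θ) := by fun_prop

instance isProbabilityMeasure_powerUniformLaw (θ : ℝ) :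
    IsProbabilityMeasure (powerUniformLaw θ) := by
  have : IsProbabilityMeasure (volume.restrict (Set.Icc (0 : ℝ) 1)) := ⟨by simp⟩
  exact Measure.isProbabilityMeasure_map (measurable_rpow_inv θ).aemeasurable

theorem ae_powerUniformLaw_iff {θ : ℝ} {p : ℝ → Prop} (hp : MeasurableSet {t | p t}) :
    (∀ᵐ t ∂powerUniformLaw θ, p t) ↔
      ∀ᵐ u ∂volume.restrict (Set.Icc (0 : ℝ) 1), p (u ^ (1 / θ)) :=
  ae_map_iff (measurable_rpow_inv θ).aemeasurable hp

theorem ae_uniform_pos : ∀ᵐ u ∂volume.restrict (Set.Icc (0 : ℝ) 1), 0 < u ∧ u ≤ 1 := by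
  have h0 : ∀ᵐ u ∂volume.restrict (Set.Icc (0 : ℝ) 1), u ≠ 0 :=
    ae_restrict_of_ae (Measure.ae_ne volume (0 : ℝ))
  filter_upwards [h0, ae_restrict_mem measurableSet_Icc] with u hu hu'
  exact ⟨lt_of_le_of_ne hu'.1 hu.symm, hu'.2⟩

theorem powerUniformLaw_ae_mem {θ : ℝ} (hθ : 0 < θ) :
    ∀ᵐ t ∂powerUniformLaw θ, 0 < t ∧ t ≤ 1 := by
  rw [ae_powerUniformLaw_iff measurableSet_Ioc]
  filter_upwards [ae_uniform_pos] with u hu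
  exact ⟨Real.rpow_pos_of_pos hu.1 _, Real.rpow_le_one hu.1.le hu.2 (by positivity)⟩

theorem log_rpow_ae_eq (θ : ℝ) :
    (fun u : ℝ => Real.log (u ^ (1 / θ))) =ᵐ[volume.restrict (Set.Icc (0 : ℝ) 1)]
      fun u => 1 / θ * Real.log u := by
  filter_upwards [ae_uniform_pos] with u hu
  exact Real.log_rpow hu.1 _

theorem integrable_log_powerUniformLaw (θ : ℝ) : Integrable Real.log (powerUniformLaw θ) := by
  rw [powerUniformLaw, integrable_map_measure Real.measurable_log.aestronglyMeasurable
    (measurable_rpow_inv θ).aemeasurable]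
  refine (Integrable.congr ?_ (log_rpow_ae_eq θ).symm)
  refine Integrable.const_mul ?_ _
  have h : IntervalIntegrable Real.log volume 0 1 := intervalIntegral.intervalIntegrable_log'
  rw [intervalIntegrable_iff_integrableOn_Icc_of_le zero_le_one] at h
  exact h

theorem integral_log_powerUniformLaw (θ : ℝ) :
    ∫ t, Real.log t ∂powerUniformLaw θ = -1 / θ := by
  rw [powerUniformLaw, integral_map (measurable_rpow_inv θ).aemeasurable
    Real.measurable_log.aestronglyMeasurable, integral_congr_ae (log_rpow_ae_eq θ),
    integral_const_mul, integral_Icc_eq_integral_Ioc,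
    ← intervalIntegral.integral_of_le zero_le_one, integral_log]
  simp [neg_div]

/-- The mass is at most 1 - (a/b)^θ ≤ θ log(b/a). Only the ratio of the endpoints enters, which
makes the next estimate uniform in `v`. -/
theorem powerUniformLaw_Icc_le {θ : ℝ} (hθ : 0 < θ) {a b : ℝ} (ha : 0 < a) (hab : a ≤ b) :
    powerUniformLaw θ (Set.Icc a b) ≤ ENNReal.ofReal (θ * (b / a - 1)) := by
  have hb : 0 < b := ha.trans_le hab
  rw [powerUniformLaw, Measure.map_apply (measurable_rpow_inv θ) measurableSet_Icc,
    Measure.restrict_apply (measurable_rpow_inv θ measurableSet_Icc)]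
  have hA : 0 < a ^ θ := Real.rpow_pos_of_pos ha θ
  have hB : 0 < b ^ θ := Real.rpow_pos_of_pos hb θ
  have hsub : (fun u : ℝ => u ^ (1 / θ)) ⁻¹' Set.Icc a b ∩ Set.Icc 0 1 ⊆
      Set.Icc (a ^ θ) (min (b ^ θ) 1) := by
    rintro u ⟨⟨h1, h2⟩, h3, h4⟩
    have hu : (u ^ (1 / θ)) ^ θ = u := by
      rw [← Real.rpow_mul h3, one_div_mul_cancel hθ.ne', Real.rpow_one]
    refine ⟨?_, le_min ?_ h4⟩
    · rw [← hu]; exact Real.rpow_le_rpow ha.le h1 hθ.le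
    · rw [← hu]; exact Real.rpow_le_rpow (by positivity) h2 hθ.le
  refine (measure_mono hsub).trans ?_
  rw [Real.volume_Icc]
  refine ENNReal.ofReal_le_ofReal ?_
  have h1 : min (b ^ θ) 1 - a ^ θ ≤ 1 - a ^ θ / b ^ θ := by
    rcases le_total (b ^ θ) 1 with h | h
    · rw [min_eq_left h]
      have : a ^ θ ≤ b ^ θ := Real.rpow_le_rpow ha.le hab hθ.le
      rw [one_sub_div hB.ne', le_div_iff₀ hB]
      nlinarith
    · rw [min_eq_right h]
      have : a ^ θ / b ^ θ ≤ a ^ θ := div_le_self hA.le h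
      linarith
  have h2 : a ^ θ / b ^ θ = Real.exp (-(θ * Real.log (b / a))) := by
    rw [← Real.div_rpow ha.le hb.le, Real.rpow_def_of_pos (div_pos ha hb), ← inv_div b a,
      Real.log_inv]
    ring_nf
  have h3 := Real.add_one_le_exp (-(θ * Real.log (b / a)))
  have h4 := Real.log_le_sub_one_of_pos (div_pos hb ha)
  have h5 := mul_le_mul_of_nonneg_left h4 hθ.le
  linarith

/-- For r ≤ 1/2 the event forces t|v| into [1 - r, 1 + r], whose endpoint ratio does not depend on
`v`; this gives 4θr. For r > 1/2 the term 2r already exceeds 1. -/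
theorem powerUniformLaw_abs_add_mul_le {θ : ℝ} (hθ : 0 < θ) {c : ℝ} (hc : |c| = 1) (v : ℝ)
    {r : ℝ} (hr : 0 ≤ r) :
    powerUniformLaw θ {t | |c + t * v| ≤ r} ≤ ENNReal.ofReal ((4 * θ + 2) * r) := by
  rcases le_or_gt r (1 / 2) with hr2 | hr2
  · have hmono : powerUniformLaw θ {t | |c + t * v| ≤ r} ≤
        powerUniformLaw θ (Set.Icc ((1 - r) / |v|) ((1 + r) / |v|)) := by
      refine measure_mono_ae ?_
      filter_upwards [powerUniformLaw_ae_mem hθ] with t ht hle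
      have hle : |c + t * v| ≤ r := hle
      have h1 : |t * v| = t * |v| := by rw [abs_mul, abs_of_pos ht.1]
      have h2 : |t * v| ≤ |c + t * v| + |c| := by
        simpa using abs_sub (c + t * v) c
      have h3 : |c| ≤ |c + t * v| + |t * v| := by
        simpa using abs_sub (c + t * v) (t * v)
      have hv : 0 < |v| := by
        rcases (abs_nonneg v).eq_or_lt with h | h
        · rw [h1, ← h] at h3; linarith
        · exact h
      constructor
      · rw [div_le_iff₀ hv]; linarith
      · rw [le_div_iff₀ hv]; linarith
    refine hmono.trans ?_
    rcases (abs_nonneg v).eq_or_lt with h | hv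
    -- Division by zero turns the interval into {0}, which is null.
    · rw [← h, div_zero, div_zero, Set.Icc_self]
      have : powerUniformLaw θ {0} = 0 := by
        refine measure_mono_null ?_ (powerUniformLaw_ae_mem hθ)
        intro t ht
        simp [Set.mem_singleton_iff.1 ht]
      rw [this]
      exact bot_le
    · refine (powerUniformLaw_Icc_le hθ (div_pos (by linarith) hv)
        (by gcongr; linarith)).trans (ENNReal.ofReal_le_ofReal ?_)
      rw [div_div_div_cancel_right₀ hv.ne', div_sub_one (by linarith), mul_div_assoc',
        div_le_iff₀ (by linarith)]
      nlinarith [mul_nonneg hθ.le hr, mul_nonneg (mul_nonneg hθ.le hr) (sub_nonneg.2 hr2)]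
  · refine prob_le_one.trans ?_
    rw [ENNReal.one_le_ofReal]
    nlinarith

/-! ### The law of the whole sequence -/

/-- The law of an i.i.d. sequence with marginals `powerUniformLaw θ`. -/
noncomputable abbrev powerUniformSeqLaw (θ : ℝ) : Measure (ℕ → ℝ) :=
  Measure.infinitePi fun _ => powerUniformLaw θ

theorem ae_isTypical {θ : ℝ} (hθ : 0 < θ) : ∀ᵐ y ∂powerUniformSeqLaw θ, IsTypical θ y := by
  have h1 : ∀ᵐ y ∂powerUniformSeqLaw θ, ∀ i, 0 < y i ∧ y i ≤ 1 := by
    rw [ae_all_iff]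
    intro i
    exact (measurePreserving_eval_infinitePi (fun _ : ℕ => powerUniformLaw θ)
      i).quasiMeasurePreserving.ae (powerUniformLaw_ae_mem hθ)
  have hmp := measurePreserving_eval_infinitePi (fun _ : ℕ => powerUniformLaw θ)
  have h2 := ProbabilityTheory.strong_law_ae_real (μ := powerUniformSeqLaw θ)
    (fun i y => Real.log (y i))
    ((hmp 0).integrable_comp_of_integrable (integrable_log_powerUniformLaw θ))
    (fun i j hij => (ProbabilityTheory.iIndepFun_infinitePi
      (X := fun _ : ℕ => Real.log) fun _ => Real.measurable_log).indepFun hij)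
    (fun i => ProbabilityTheory.IdentDistrib.comp (u := Real.log)
      ⟨(measurable_pi_apply i).aemeasurable, (measurable_pi_apply 0).aemeasurable,
        (hmp i).map_eq.trans (hmp 0).map_eq.symm⟩ Real.measurable_log)
  have h3 : ∫ y, Real.log (y 0) ∂powerUniformSeqLaw θ = -1 / θ := by
    rw [← integral_log_powerUniformLaw, ← (hmp 0).map_eq,
      integral_map (measurable_pi_apply 0).aemeasurable
        Real.measurable_log.aestronglyMeasurable]
  rw [h3] at h2
  filter_upwards [h1, h2] with y hy1 hy2
  exact ⟨hy1, hy2⟩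

/-- Prepend a term to a sequence. -/
def seqCons (t : ℝ) (y : ℕ → ℝ) : ℕ → ℝ
  | 0 => t
  | n + 1 => y n

theorem measurable_seqCons : Measurable fun p : ℝ × (ℕ → ℝ) => seqCons p.1 p.2 := by
  refine measurable_pi_lambda _ fun n => ?_
  cases n with
  | zero => exact measurable_fst
  | succ n => exact (measurable_pi_apply n).comp measurable_snd

/-- This allows integrating out the first factor with all later ones held fixed. -/
theorem map_seqCons (θ : ℝ) :
    ((powerUniformLaw θ).prod (powerUniformSeqLaw θ)).map (fun p => seqCons p.1 p.2) =
      powerUniformSeqLaw θ := by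
  classical
  refine Measure.eq_infinitePi _ fun s t ht => ?_
  -- Enlarging the index set to an initial segment lets coordinate 0 split off and the others shift
  -- down.
  obtain ⟨N, hN⟩ : ∃ N, s ⊆ Finset.range (N + 1) :=
    ⟨s.sup id, fun i hi => Finset.mem_range.2 (Nat.lt_succ_of_le (Finset.le_sup (f := id) hi))⟩
  set t' : ℕ → Set ℝ := fun i => if i ∈ s then t i else Set.univ with ht'
  have hm : ∀ i, MeasurableSet (t' i) := fun i => by
    simp only [ht']; split_ifs
    exacts [ht i, MeasurableSet.univ]
  have hpi : Set.pi (s : Set ℕ) t = Set.pi (Finset.range (N + 1) : Set ℕ) t' := by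
    ext y
    simp only [Set.mem_pi, ht']
    constructor
    · intro h i _
      split_ifs with his
      exacts [h i his, trivial]
    · intro h i hi
      have := h i (hN hi)
      rwa [if_pos (by exact hi)] at this
  have hprod : ∏ i ∈ s, powerUniformLaw θ (t i) =
      ∏ i ∈ Finset.range (N + 1), powerUniformLaw θ (t' i) := by
    refine Finset.prod_subset_one_on_sdiff hN (fun i hi => ?_) (fun i hi => ?_)
    · simp [ht', (Finset.mem_sdiff.1 hi).2]
    · simp [ht', hi]
  have hpre : (fun p : ℝ × (ℕ → ℝ) => seqCons p.1 p.2) ⁻¹'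
      Set.pi (Finset.range (N + 1) : Set ℕ) t' =
      t' 0 ×ˢ Set.pi (Finset.range N : Set ℕ) fun i => t' (i + 1) := by
    ext ⟨u, y⟩
    simp only [Set.mem_preimage, Set.mem_pi, Set.mem_prod, Finset.coe_range, Set.mem_Iio]
    constructor
    · intro h
      exact ⟨h 0 N.succ_pos, fun i hi => h (i + 1) (Nat.succ_lt_succ hi)⟩
    · rintro ⟨h0, h1⟩ i hi
      cases i with
      | zero => exact h0
      | succ i => exact h1 i (Nat.lt_of_succ_lt_succ hi)
  rw [hpi, Measure.map_apply measurable_seqCons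
    (MeasurableSet.pi (Finset.countable_toSet _) fun i _ => hm i), hpre, Measure.prod_prod,
    Measure.infinitePi_pi _ fun i _ => hm (i + 1), hprod, Finset.prod_range_succ', mul_comm]

theorem measurePreserving_seq_add (θ : ℝ) (N : ℕ) :
    MeasurePreserving (fun (y : ℕ → ℝ) i => y (i + N)) (powerUniformSeqLaw θ)
      (powerUniformSeqLaw θ) :=
  ⟨by fun_prop, Measure.map_infinitePi_infinitePi_of_inj
    (P := fun _ : ℕ => powerUniformLaw θ) (add_left_injective N)⟩

/-! ### Digit sums and their differences -/

/-- Positive sequences with summable partial products. -/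
def SummableProd (y : ℕ → ℝ) : Prop := (∀ i, 0 < y i) ∧ Summable (partialProd y)

theorem IsTypical.summableProd {θ : ℝ} (hθ : 0 < θ) {y : ℕ → ℝ} (hy : IsTypical θ y) :
    SummableProd y := ⟨hy.pos, hy.summable_partialProd hθ⟩

theorem partialProd_succ (y : ℕ → ℝ) (n : ℕ) :
    partialProd y (n + 1) = y 0 * partialProd (fun i => y (i + 1)) n := by
  rw [partialProd, Finset.prod_range_succ', mul_comm, partialProd]

theorem SummableProd.tail {y : ℕ → ℝ} (hy : SummableProd y) :
    SummableProd fun i => y (i + 1) := by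
  refine ⟨fun i => hy.1 _, ?_⟩
  have h := (summable_nat_add_iff 1).2 hy.2
  simp only [partialProd_succ] at h
  exact (summable_mul_left_iff (hy.1 0).ne').1 h

theorem SummableProd.seqCons {t : ℝ} (ht : 0 < t) {y : ℕ → ℝ} (hy : SummableProd y) :
    SummableProd (seqCons t y) := by
  refine ⟨fun i => ?_, ?_⟩
  · cases i with
    | zero => exact ht
    | succ i => exact hy.1 i
  · rw [← summable_nat_add_iff 1]
    simp only [partialProd_succ]
    exact hy.2.mul_left t

/-- The sum `∑ a_i X_i`, where `X` are the partial products of `y`. -/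
noncomputable def digitSum (y a : ℕ → ℝ) : ℝ :=
  (∑' i, ENNReal.ofReal (a i * partialProd y i)).toReal

theorem SummableProd.hasSum_digitSum {y a : ℕ → ℝ} (hy : SummableProd y)
    (ha : ∀ i, a i = 0 ∨ a i = 1) : HasSum (fun i => a i * partialProd y i) (digitSum y a) := by
  have hp := partialProd_pos hy.1
  have hnn : ∀ i, 0 ≤ a i * partialProd y i := fun i => by
    rcases ha i with h | h <;> simp [h, (hp i).le]
  have hle : ∀ i, a i * partialProd y i ≤ partialProd y i := fun i => by
    rcases ha i with h | h <;> simp [h, (hp i).le]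
  have hs := Summable.of_nonneg_of_le hnn hle hy.2
  rw [digitSum, ← ENNReal.ofReal_tsum_of_nonneg hnn hs, ENNReal.toReal_ofReal (tsum_nonneg hnn)]
  exact hs.hasSum

theorem SummableProd.digitSum_eq {y a : ℕ → ℝ} (hy : SummableProd y)
    (ha : ∀ i, a i = 0 ∨ a i = 1) :
    digitSum y a = y 0 * (a 0 + digitSum (fun i => y (i + 1)) fun i => a (i + 1)) := by
  have h := hy.hasSum_digitSum ha
  have h' := hy.tail.hasSum_digitSum fun i => ha (i + 1)
  rw [← h.tsum_eq, h.summable.tsum_eq_zero_add, mul_add, ← h'.tsum_eq, ← tsum_mul_left]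
  congr 1
  · simp [partialProd, mul_comm]
  · refine tsum_congr fun i => ?_
    rw [partialProd_succ]
    ring

theorem SummableProd.digitSum_sub {y a b : ℕ → ℝ} (hy : SummableProd y)
    (ha : ∀ i, a i = 0 ∨ a i = 1) (hb : ∀ i, b i = 0 ∨ b i = 1) {N : ℕ}
    (hab : ∀ i < N, a i = b i) :
    digitSum y a - digitSum y b = partialProd y N * ((a N - b N) +
      (digitSum (fun i => y (i + (N + 1))) (fun i => a (i + (N + 1))) -
        digitSum (fun i => y (i + (N + 1))) (fun i => b (i + (N + 1))))) := by
  induction N generalizing y a b with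
  | zero =>
    rw [hy.digitSum_eq ha, hy.digitSum_eq hb]
    simp only [partialProd, zero_add, Finset.prod_range_one]
    ring
  | succ N ih =>
    have h := ih hy.tail (fun i => ha (i + 1)) (fun i => hb (i + 1))
      fun i hi => hab (i + 1) (Nat.succ_lt_succ hi)
    rw [hy.digitSum_eq ha, hy.digitSum_eq hb, partialProd_succ, hab 0 N.succ_pos, mul_assoc,
      ← mul_sub, add_sub_add_left_eq_sub, h]
    rfl

theorem measurable_partialProd (n : ℕ) : Measurable fun y => partialProd y n := by
  unfold partialProd
  fun_prop

/-- Summing in `ENNReal` gives joint measurability with no summability assumption. -/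
theorem measurable_digitSum {α : Type*} [MeasurableSpace α] {f g : α → ℕ → ℝ}
    (hf : Measurable f) (hg : Measurable g) : Measurable fun x => digitSum (f x) (g x) := by
  unfold digitSum
  refine Measurable.ennreal_toReal (Measurable.tsum fun i => ?_)
  exact (((measurable_pi_apply i).comp hg).mul
    ((measurable_partialProd i).comp hf)).ennreal_ofReal

/-! ### Probability that two digit sums are close -/

/-- The difference of the sums is y_0 v with v a function of the later factors, so the one-factor
estimate applies conditionally on them. -/
theorem powerUniformSeqLaw_abs_add_digitSum_sub_le {θ : ℝ} (hθ : 0 < θ) {a b : ℕ → ℝ}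
    (ha : ∀ i, a i = 0 ∨ a i = 1) (hb : ∀ i, b i = 0 ∨ b i = 1) {c : ℝ} (hc : |c| = 1)
    {r : ℝ} (hr : 0 ≤ r) :
    powerUniformSeqLaw θ {y | |c + (digitSum y a - digitSum y b)| ≤ r} ≤
      ENNReal.ofReal ((4 * θ + 2) * r) := by
  have hmeas : ∀ a b : ℕ → ℝ,
      MeasurableSet {y : ℕ → ℝ | |c + (digitSum y a - digitSum y b)| ≤ r} := by
    intro a b
    refine measurableSet_le ?_ measurable_const
    exact (measurable_const.add ((measurable_digitSum measurable_id measurable_const).sub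
      (measurable_digitSum measurable_id measurable_const))).abs
  conv_lhs => rw [← map_seqCons θ]
  rw [Measure.map_apply measurable_seqCons (hmeas a b),
    Measure.prod_apply_symm (measurable_seqCons (hmeas a b))]
  refine (lintegral_mono_ae (g := fun _ => ENNReal.ofReal ((4 * θ + 2) * r)) ?_).trans_eq
    (by simp)
  filter_upwards [ae_isTypical hθ] with y hy
  refine (measure_mono_ae ?_).trans (powerUniformLaw_abs_add_mul_le hθ hc
    ((a 0 + digitSum y fun i => a (i + 1)) - (b 0 + digitSum y fun i => b (i + 1))) hr)
  filter_upwards [powerUniformLaw_ae_mem hθ] with t ht h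
  have hs := (hy.summableProd hθ).seqCons ht.1
  have h' : |c + (digitSum (seqCons t y) a - digitSum (seqCons t y) b)| ≤ r := h
  rw [hs.digitSum_eq ha, hs.digitSum_eq hb, ← mul_sub] at h'
  exact h'

/-- Sequences whose partial products decay at rate at most `γ`, with constant `M`. -/
def decaySet (γ M : ℝ) : Set (ℕ → ℝ) :=
  {y | SummableProd y ∧ ∀ n : ℕ, Real.exp (-γ * (n + 1)) ≤ M * partialProd y n}

theorem powerUniformSeqLaw_restrict_abs_digitSum_sub_le {θ γ M s r : ℝ} (hθ : 0 < θ)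
    (hM : 0 < M) (hs0 : 0 < s) (hs1 : s ≤ 1) (hγ : 0 < γ) (hr : 0 ≤ r) {x x' : ℝ}
    (hx : Int.fract x ≠ Int.fract x') :
    (powerUniformSeqLaw θ).restrict (decaySet γ M)
        {y | |digitSum y (goldenDigit x) - digitSum y (goldenDigit x')| ≤ r} ≤
      ENNReal.ofReal (((4 * θ + 2) * M * Real.exp γ) ^ s * r ^ s *
        |Int.fract x - Int.fract x'| ^ (-(γ * s / Real.log Real.goldenRatio))) := by
  classical
  set N := Nat.find (exists_goldenDigit_ne hx) with hN
  have hne : goldenDigit x N ≠ goldenDigit x' N := Nat.find_spec (exists_goldenDigit_ne hx)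
  have heq : ∀ i < N, goldenDigit x i = goldenDigit x' i := fun i hi =>
    not_not.1 (Nat.find_min (exists_goldenDigit_ne hx) hi)
  have hc : |goldenDigit x N - goldenDigit x' N| = 1 := by
    rcases goldenDigit_eq_zero_or_one x N with h | h <;>
    rcases goldenDigit_eq_zero_or_one x' N with h' | h' <;> rw [h, h'] at hne ⊢ <;> simp at hne ⊢
  have hmeas : MeasurableSet {y : ℕ → ℝ | |goldenDigit x N - goldenDigit x' N +
      (digitSum y (fun i => goldenDigit x (i + (N + 1))) -
        digitSum y (fun i => goldenDigit x' (i + (N + 1))))| ≤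
      r * M * Real.exp (γ * (N + 1))} := by
    refine measurableSet_le ?_ measurable_const
    exact (measurable_const.add ((measurable_digitSum measurable_id measurable_const).sub
      (measurable_digitSum measurable_id measurable_const))).abs
  have hset : MeasurableSet
      {y | |digitSum y (goldenDigit x) - digitSum y (goldenDigit x')| ≤ r} :=
    measurableSet_le ((measurable_digitSum measurable_id measurable_const).sub
      (measurable_digitSum measurable_id measurable_const)).abs measurable_const
  have hsub : {y | |digitSum y (goldenDigit x) - digitSum y (goldenDigit x')| ≤ r} ∩
      decaySet γ M ⊆ (fun (y : ℕ → ℝ) i => y (i + (N + 1))) ⁻¹'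
      {y | |goldenDigit x N - goldenDigit x' N +
      (digitSum y (fun i => goldenDigit x (i + (N + 1))) -
        digitSum y (fun i => goldenDigit x' (i + (N + 1))))| ≤
      r * M * Real.exp (γ * (N + 1))} := by
    rintro y ⟨hy, hyS, hyM⟩
    have hy : |digitSum y (goldenDigit x) - digitSum y (goldenDigit x')| ≤ r := hy
    have hp := partialProd_pos hyS.1 N
    rw [hyS.digitSum_sub (goldenDigit_eq_zero_or_one x) (goldenDigit_eq_zero_or_one x') heq,
      abs_mul, abs_of_pos hp] at hy
    rw [Set.mem_preimage, Set.mem_ofPred_eq]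
    set w := |goldenDigit x N - goldenDigit x' N +
      (digitSum (fun i => y (i + (N + 1))) (fun i => goldenDigit x (i + (N + 1))) -
        digitSum (fun i => y (i + (N + 1))) (fun i => goldenDigit x' (i + (N + 1))))|
    have hw : 0 ≤ w := abs_nonneg _
    have h1 := hyM N
    rw [neg_mul, Real.exp_neg] at h1
    have h2 : 0 < Real.exp (γ * (N + 1)) := Real.exp_pos _
    rw [inv_le_iff_one_le_mul₀ h2] at h1
    calc w ≤ w * (M * partialProd y N * Real.exp (γ * (N + 1))) := le_mul_of_one_le_right hw h1
      _ = (partialProd y N * w) * (M * Real.exp (γ * (N + 1))) := by ring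
      _ ≤ r * (M * Real.exp (γ * (N + 1))) := by gcongr
      _ = _ := by ring
  rw [Measure.restrict_apply hset]
  have hb := (measure_mono (μ := powerUniformSeqLaw θ) hsub).trans_eq
    ((measurePreserving_seq_add θ (N + 1)).measure_preimage hmeas.nullMeasurableSet)
  have hb2 := hb.trans (powerUniformSeqLaw_abs_add_digitSum_sub_le hθ
    (fun i => goldenDigit_eq_zero_or_one x _) (fun i => goldenDigit_eq_zero_or_one x' _) hc
    (by positivity))
  set A := (4 * θ + 2) * (r * M * Real.exp (γ * (N + 1))) with hA
  have hA0 : 0 ≤ A := by positivity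
  have hb3 : (powerUniformSeqLaw θ) ({y | |digitSum y (goldenDigit x) -
      digitSum y (goldenDigit x')| ≤ r} ∩ decaySet γ M) ≤ ENNReal.ofReal (A ^ s) := by
    -- A probability bounded by A is at most min(A, 1) ≤ A^s; this trades decay in `r` for a milder
    -- singularity in |x - x'|.
    rcases le_total A 1 with h | h
    · refine hb2.trans (ENNReal.ofReal_le_ofReal ?_)
      rcases hA0.eq_or_lt with h0 | h0
      · rw [← h0, Real.zero_rpow hs0.ne']
      · exact Real.self_le_rpow_of_le_one hA0 h hs1
    · exact prob_le_one.trans (ENNReal.one_le_ofReal.2 (Real.one_le_rpow h hs0.le))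
  refine hb3.trans (ENNReal.ofReal_le_ofReal ?_)
  have hlog : 0 < Real.log Real.goldenRatio := Real.log_pos Real.one_lt_goldenRatio
  have hD : 0 < |Int.fract x - Int.fract x'| := abs_pos.2 (sub_ne_zero.2 hx)
  have hφ := goldenRatio_pow_mul_abs_le heq
  rw [← le_div_iff₀ hD, one_div] at hφ
  -- exp(γN) is a power of φ^N, which is at most 1/|x - x'|.
  have hexp : Real.exp (γ * N) ^ s ≤
      |Int.fract x - Int.fract x'| ^ (-(γ * s / Real.log Real.goldenRatio)) := by
    rw [Real.rpow_neg hD.le, ← Real.inv_rpow hD.le]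
    refine le_trans (le_of_eq ?_) (Real.rpow_le_rpow (pow_nonneg Real.goldenRatio_pos.le _) hφ
      (by positivity))
    rw [← Real.rpow_natCast, ← Real.rpow_mul Real.goldenRatio_pos.le,
      Real.rpow_def_of_pos Real.goldenRatio_pos, ← Real.exp_mul]
    congr 1
    field_simp
  have hAeq : A = ((4 * θ + 2) * M * Real.exp γ) * r * Real.exp (γ * N) := by
    rw [hA, mul_add, Real.exp_add, mul_one]
    ring
  rw [hAeq, Real.mul_rpow (by positivity) (by positivity), Real.mul_rpow (by positivity) hr]
  gcongr

/-- Every difference x - x' lies in [-1, 1], so the integral of |t|^(-α) there serves for all `x`.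
-/
theorem exists_lintegral_abs_sub_rpow_le {α : ℝ} (hα : α < 1) :
    ∃ K : ENNReal, K ≠ ⊤ ∧ ∀ x ∈ Set.Ico (0 : ℝ) 1,
      ∫⁻ x' in Set.Ico (0 : ℝ) 1, ENNReal.ofReal (|x - x'| ^ (-α)) ≤ K := by
  have h1 : IntervalIntegrable (fun t : ℝ => |t| ^ (-α)) volume 0 1 := by
    refine (intervalIntegral.intervalIntegrable_rpow' (show -1 < -α by linarith)).congr ?_
    intro t ht
    rw [Set.uIoc_of_le zero_le_one] at ht
    simp only [abs_of_pos ht.1]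
  have h2 : IntervalIntegrable (fun t : ℝ => |t| ^ (-α)) volume (-1) 0 := by
    have := (IntervalIntegrable.iff_comp_neg (f := fun t : ℝ => |t| ^ (-α))).1 h1
    simpa using this.symm
  have h3 := h2.trans h1
  rw [intervalIntegrable_iff_integrableOn_Icc_of_le (by norm_num)] at h3
  refine ⟨∫⁻ t, (Set.Icc (-1 : ℝ) 1).indicator (fun t => ENNReal.ofReal (|t| ^ (-α))) t,
    ?_, fun x hx => ?_⟩
  · rw [lintegral_indicator measurableSet_Icc]
    exact h3.lintegral_lt_top.ne
  · rw [← lintegral_sub_left_eq_self (μ := volume) _ x, ← lintegral_indicator measurableSet_Ico]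
    refine lintegral_mono fun x' => ?_
    by_cases hx' : x' ∈ Set.Ico (0 : ℝ) 1
    · rw [Set.indicator_of_mem hx', Set.indicator_of_mem]
      constructor <;> linarith [hx.1, hx.2, hx'.1, hx'.2]
    · rw [Set.indicator_of_notMem hx']
      exact bot_le

theorem measurable_goldenDigit_seq : Measurable goldenDigit :=
  measurable_pi_lambda _ measurable_goldenDigit

theorem measurableSet_abs_digitSum_sub_le (r : ℝ) :
    MeasurableSet {q : (ℕ → ℝ) × (ℝ × ℝ) |
      |digitSum q.1 (goldenDigit q.2.1) - digitSum q.1 (goldenDigit q.2.2)| ≤ r} := by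
  refine measurableSet_le (Measurable.abs (Measurable.sub ?_ ?_)) measurable_const
  · exact measurable_digitSum measurable_fst
      (measurable_goldenDigit_seq.comp (measurable_fst.comp measurable_snd))
  · exact measurable_digitSum measurable_fst
      (measurable_goldenDigit_seq.comp (measurable_snd.comp measurable_snd))

/-- Tonelli: integrate over the random sequence first, then the kernel over pairs. γs < log φ is
exactly integrability of the kernel. -/
theorem exists_lintegral_prod_abs_digitSum_sub_le {θ γ M s : ℝ} (hθ : 0 < θ)
    (hM : 0 < M) (hs0 : 0 < s) (hs1 : s ≤ 1) (hγ : 0 < γ)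
    (hlt : γ * s < Real.log Real.goldenRatio) :
    ∃ K : ENNReal, K ≠ ⊤ ∧ ∀ r : ℝ, 0 ≤ r →
      ∫⁻ y in decaySet γ M, ((volume.restrict (Set.Ico (0 : ℝ) 1)).prod
        (volume.restrict (Set.Ico (0 : ℝ) 1)))
        {p | |digitSum y (goldenDigit p.1) - digitSum y (goldenDigit p.2)| ≤ r}
          ∂powerUniformSeqLaw θ ≤ K * ENNReal.ofReal (r ^ s) := by
  have hlog : 0 < Real.log Real.goldenRatio := Real.log_pos Real.one_lt_goldenRatio
  obtain ⟨K, hK, hKle⟩ := exists_lintegral_abs_sub_rpow_le ((div_lt_one hlog).2 hlt)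
  set B := ((4 * θ + 2) * M * Real.exp γ) ^ s with hB
  have hB0 : 0 ≤ B := by positivity
  refine ⟨ENNReal.ofReal B * K, ENNReal.mul_ne_top ENNReal.ofReal_ne_top hK, fun r hr => ?_⟩
  set ρ : Measure ℝ := volume.restrict (Set.Ico (0 : ℝ) 1) with hρ
  have hρ1 : ρ Set.univ = 1 := by simp [hρ]
  have hE := measurableSet_abs_digitSum_sub_le r
  have hswap := (Measure.prod_apply (μ := (powerUniformSeqLaw θ).restrict (decaySet γ M))
    (ν := ρ.prod ρ) hE).symm.trans (Measure.prod_apply_symm hE)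
  refine hswap.trans_le ?_
  rw [lintegral_prod _ (measurable_measure_prodMk_right hE).aemeasurable]
  have hbound : ∀ᵐ x ∂ρ, (∫⁻ x', (powerUniformSeqLaw θ).restrict (decaySet γ M)
      ((fun y => (y, (x, x'))) ⁻¹' {q : (ℕ → ℝ) × (ℝ × ℝ) |
      |digitSum q.1 (goldenDigit q.2.1) - digitSum q.1 (goldenDigit q.2.2)| ≤ r}) ∂ρ) ≤
      ENNReal.ofReal B * K * ENNReal.ofReal (r ^ s) := by
    filter_upwards [ae_restrict_mem measurableSet_Ico] with x hx
    have hne : ∀ᵐ x' ∂ρ, x' ≠ x := ae_restrict_of_ae (Measure.ae_ne volume x)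
    have hpt : ∀ᵐ x' ∂ρ, (powerUniformSeqLaw θ).restrict (decaySet γ M)
        ((fun y => (y, (x, x'))) ⁻¹' {q : (ℕ → ℝ) × (ℝ × ℝ) |
        |digitSum q.1 (goldenDigit q.2.1) - digitSum q.1 (goldenDigit q.2.2)| ≤ r}) ≤
        ENNReal.ofReal (B * r ^ s) * ENNReal.ofReal
          (|x - x'| ^ (-(γ * s / Real.log Real.goldenRatio))) := by
      filter_upwards [hne, ae_restrict_mem measurableSet_Ico] with x' hxx' hx'
      have hf : Int.fract x = x := Int.fract_eq_self.2 hx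
      have hf' : Int.fract x' = x' := Int.fract_eq_self.2 hx'
      have h := powerUniformSeqLaw_restrict_abs_digitSum_sub_le (θ := θ) (M := M) (s := s)
        (γ := γ) hθ hM hs0 hs1 hγ hr (x := x) (x' := x') (by rw [hf, hf']; exact hxx'.symm)
      rw [hf, hf', ENNReal.ofReal_mul (by positivity)] at h
      exact h
    refine (lintegral_mono_ae hpt).trans ?_
    rw [lintegral_const_mul' _ _ ENNReal.ofReal_ne_top, ENNReal.ofReal_mul hB0]
    calc _ ≤ ENNReal.ofReal B * ENNReal.ofReal (r ^ s) * K := by gcongr; exact hKle x hx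
      _ = _ := by ring
  refine (lintegral_mono_ae hbound).trans_eq ?_
  rw [lintegral_const, hρ1, mul_one]

/-! ### Absolute continuity and dimension from ball masses -/

theorem measurable_measure_closedBall (ν : Measure ℝ) [IsFiniteMeasure ν] (r : ℝ) :
    Measurable fun u => ν (Metric.closedBall u r) := by
  have h : MeasurableSet {p : ℝ × ℝ | dist p.2 p.1 ≤ r} :=
    measurableSet_le (measurable_snd.dist measurable_fst) measurable_const
  exact measurable_measure_prodMk_left h

theorem prod_abs_sub_le_eq_lintegral {ρ : Measure ℝ} [IsFiniteMeasure ρ] {f : ℝ → ℝ}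
    (hf : Measurable f) (r : ℝ) :
    (ρ.prod ρ) {p | |f p.1 - f p.2| ≤ r} =
      ∫⁻ u, ρ.map f (Metric.closedBall u r) ∂ρ.map f := by
  rw [lintegral_map (measurable_measure_closedBall _ r) hf]
  have hm : MeasurableSet {p : ℝ × ℝ | |f p.1 - f p.2| ≤ r} :=
    measurableSet_le ((hf.comp measurable_fst).sub (hf.comp measurable_snd)).abs
      measurable_const
  rw [Measure.prod_apply hm]
  refine lintegral_congr fun x => ?_
  rw [Measure.map_apply hf Metric.isClosed_closedBall.measurableSet]
  congr 1
  ext x'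
  simp [Real.dist_eq, abs_sub_comm]

/-- By Fatou the lower density of ν is finite ν-almost everywhere. Where it is below m, arbitrarily
small balls have mass at most m times their volume, and the Besicovitch covering theorem gives ν ≤ m
· `volume` there. -/
theorem measure_eq_zero_of_liminf_lintegral_closedBall {ν : Measure ℝ} [IsFiniteMeasure ν]
    (h : Filter.liminf (fun k : ℕ => (2 : ENNReal) ^ k *
      ∫⁻ u, ν (Metric.closedBall u ((1 / 2) ^ k)) ∂ν) Filter.atTop ≠ ⊤)
    {S : Set ℝ} (hS : volume S = 0) : ν S = 0 := by
  set g : ℕ → ℝ → ENNReal := fun k u => 2 ^ k * ν (Metric.closedBall u ((1 / 2) ^ k)) with hg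
  have hgm : ∀ k, Measurable (g k) := fun k => (measurable_measure_closedBall ν _).const_mul _
  have hfin : ∀ᵐ u ∂ν, Filter.liminf (fun k => g k u) Filter.atTop < ⊤ := by
    refine ae_lt_top (Measurable.liminf hgm) (ne_top_of_le_ne_top h ?_)
    refine (lintegral_liminf_le hgm).trans_eq ?_
    simp only [hg, lintegral_const_mul _ (measurable_measure_closedBall ν _)]
  have hnull : ∀ m : ℕ, ν (S ∩ {u | Filter.liminf (fun k => g k u) Filter.atTop < m}) = 0 := by
    intro m
    refine le_antisymm ?_ bot_le
    have hle := (Besicovitch.vitaliFamily ν).measure_le_of_frequently_le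
      ((m : NNReal) • (volume : Measure ℝ)) Measure.AbsolutelyContinuous.rfl
      (S ∩ {u | Filter.liminf (fun k => g k u) Filter.atTop < m}) (fun u hu => ?_)
    · refine hle.trans ?_
      rw [Measure.smul_apply, measure_mono_null Set.inter_subset_left hS, smul_zero]
    · have hfr := Filter.frequently_lt_of_liminf_lt (by isBoundedDefault)
        (show Filter.liminf (fun k => g k u) Filter.atTop < m from hu.2)
      have ht : Filter.Tendsto (fun k : ℕ => ((1 : ℝ) / 2) ^ k) Filter.atTop
          (nhdsWithin 0 (Set.Ioi 0)) :=
        tendsto_nhdsWithin_iff.2 ⟨tendsto_pow_atTop_nhds_zero_of_lt_one (by norm_num)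
          (by norm_num), Filter.Eventually.of_forall fun k => by
            simp only [Set.mem_Ioi]; positivity⟩
      refine ((Besicovitch.tendsto_filterAt ν u).comp ht).frequently (hfr.mono fun k hk => ?_)
      have h2 : (2 : ENNReal) ^ k * ENNReal.ofReal ((1 / 2) ^ k) = 1 := by
        rw [← ENNReal.ofReal_ofNat, ← ENNReal.ofReal_pow (by norm_num),
          ← ENNReal.ofReal_mul (by positivity), ← mul_pow]
        norm_num
      simp only [Function.comp, Measure.smul_apply, Real.volume_closedBall]
      calc ν (Metric.closedBall u ((1 / 2) ^ k))
          = ENNReal.ofReal ((1 / 2) ^ k) * g k u := by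
            rw [hg]; simp only
            rw [← mul_assoc, mul_comm (ENNReal.ofReal _), h2, one_mul]
        _ ≤ ENNReal.ofReal (2 * (1 / 2) ^ k) * m := by
            gcongr
            linarith [pow_pos (show (0 : ℝ) < 1 / 2 by norm_num) k]
        _ = _ := by rw [mul_comm]; simp [ENNReal.smul_def]
  have hae : ∀ᵐ u ∂ν, ∀ m : ℕ,
      u ∉ S ∩ {u | Filter.liminf (fun k => g k u) Filter.atTop < m} :=
    ae_all_iff.2 fun m => measure_eq_zero_iff_ae_notMem.1 (hnull m)
  refine measure_eq_zero_iff_ae_notMem.2 ?_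
  filter_upwards [hae, hfin] with u hu hu' huS
  obtain ⟨m, hm⟩ := ENNReal.exists_nat_gt hu'.ne
  exact hu m ⟨huS, hm⟩

theorem measure_le_mul_ediam_rpow {ν : Measure ℝ} {s : ℝ} (hs : 0 < s) {C : ENNReal}
    (hC : C ≠ ⊤) {u : ℝ}
    (hu : ∀ k : ℕ, ν (Metric.closedBall u ((1 / 2) ^ k)) ≤
      C * ENNReal.ofReal (((1 / 2 : ℝ) ^ k) ^ s))
    {U : Set ℝ} (huU : u ∈ U) (hU : Metric.ediam U ≤ 1) :
    ν U ≤ C * ENNReal.ofReal (2 ^ s) * Metric.ediam U ^ s := by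
  set d := (Metric.ediam U).toReal with hd
  have hdU : Metric.ediam U = ENNReal.ofReal d :=
    (ENNReal.ofReal_toReal (ne_top_of_le_ne_top ENNReal.one_ne_top hU)).symm
  have hd0 : 0 ≤ d := ENNReal.toReal_nonneg
  have hd1 : d ≤ 1 := by
    rw [hdU, ENNReal.ofReal_le_one] at hU
    exact hU
  have hball : ∀ k : ℕ, d ≤ (1 / 2) ^ k → ν U ≤ C * ENNReal.ofReal (((1 / 2 : ℝ) ^ k) ^ s) := by
    intro k hk
    refine (measure_mono fun v hv => ?_).trans (hu k)
    have h := Metric.edist_le_ediam_of_mem hv huU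
    rw [hdU, edist_dist, ENNReal.ofReal_le_ofReal_iff hd0] at h
    exact h.trans hk
  rcases hd0.eq_or_lt with h0 | h0
  · have ht : Filter.Tendsto (fun k : ℕ => C * ENNReal.ofReal (((1 / 2 : ℝ) ^ k) ^ s))
        Filter.atTop (nhds 0) := by
      have h1 : Filter.Tendsto (fun k : ℕ => (((1 : ℝ) / 2) ^ k) ^ s) Filter.atTop
          (nhds (0 ^ s)) :=
        (tendsto_pow_atTop_nhds_zero_of_lt_one (by norm_num) (by norm_num)).rpow_const
          (Or.inr hs.le)
      rw [Real.zero_rpow hs.ne'] at h1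
      have h2 := ENNReal.Tendsto.const_mul (ENNReal.tendsto_ofReal h1) (Or.inr hC)
      simpa using h2
    refine le_trans ?_ bot_le
    refine ge_of_tendsto' ht fun k => hball k ?_
    rw [← h0]; positivity
  -- The dyadic radius satisfies d ≤ 2^(-k) < 2d; hence the factor 2^s.
  · obtain ⟨k, hk1, hk2⟩ := exists_nat_pow_near_of_lt_one h0 hd1
      (show (0 : ℝ) < 1 / 2 by norm_num) (by norm_num)
    refine (hball k hk2).trans ?_
    rw [hdU, ENNReal.ofReal_rpow_of_pos h0, mul_assoc, ← ENNReal.ofReal_mul (by positivity),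
      ← Real.mul_rpow (by norm_num) hd0]
    gcongr
    rw [pow_succ] at hk1
    linarith

/-- Mass distribution principle: on {g ≤ m} all dyadic balls have mass O(2^(-ks)), so ν restricted
there is dominated by a multiple of `μH[s]`, and some such piece charges `S`. -/
theorem le_dimH_of_lintegral_tsum_closedBall {ν : Measure ℝ} [IsFiniteMeasure ν] {s : ℝ}
    (hs : 0 < s)
    (h : ∫⁻ u, ∑' k : ℕ, ν (Metric.closedBall u ((1 / 2) ^ k)) *
      ENNReal.ofReal (((1 / 2 : ℝ) ^ k) ^ (-s)) ∂ν ≠ ⊤)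
    {S : Set ℝ} (hS : ν S ≠ 0) : ENNReal.ofReal s ≤ dimH S := by
  set g : ℝ → ENNReal := fun u => ∑' k : ℕ, ν (Metric.closedBall u ((1 / 2) ^ k)) *
      ENNReal.ofReal (((1 / 2 : ℝ) ^ k) ^ (-s)) with hg
  have hgm : Measurable g :=
    Measurable.tsum fun k => (measurable_measure_closedBall ν _).mul_const _
  have hfin : ∀ᵐ u ∂ν, g u < ⊤ := ae_lt_top hgm h
  obtain ⟨m, hm⟩ : ∃ m : ℕ, ν (S ∩ {u | g u ≤ m}) ≠ 0 := by
    by_contra! hall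
    refine hS (measure_eq_zero_iff_ae_notMem.2 ?_)
    have hae : ∀ᵐ u ∂ν, ∀ m : ℕ, u ∉ S ∩ {u | g u ≤ m} :=
      ae_all_iff.2 fun m => measure_eq_zero_iff_ae_notMem.1 (hall m)
    filter_upwards [hae, hfin] with u hu hu' huS
    obtain ⟨m, hm⟩ := ENNReal.exists_nat_gt hu'.ne
    exact hu m ⟨huS, hm.le⟩
  have hA : MeasurableSet {u | g u ≤ m} := measurableSet_le hgm measurable_const
  set C : ENNReal := (m + 1) * ENNReal.ofReal (2 ^ s) with hC
  have hC0 : C ≠ 0 := mul_ne_zero (by simp) (by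
    rw [Ne, ENNReal.ofReal_eq_zero, not_le]; positivity)
  have hCt : C ≠ ⊤ := ENNReal.mul_ne_top (by finiteness) ENNReal.ofReal_ne_top
  have hle : C⁻¹ • ν.restrict {u | g u ≤ m} ≤ μH[s] := by
    refine Measure.le_hausdorffMeasure s _ 1 one_pos fun U hU => ?_
    rw [Measure.smul_apply, smul_eq_mul, Measure.restrict_apply' hA]
    rcases Set.eq_empty_or_nonempty (U ∩ {u | g u ≤ m}) with he | ⟨u, huU, hug⟩
    · simp [he]
    · have hk : ∀ k : ℕ, ν (Metric.closedBall u ((1 / 2) ^ k)) ≤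
          (m + 1 : ENNReal) * ENNReal.ofReal (((1 / 2 : ℝ) ^ k) ^ s) := by
        intro k
        have h1 : ν (Metric.closedBall u ((1 / 2) ^ k)) *
            ENNReal.ofReal (((1 / 2 : ℝ) ^ k) ^ (-s)) ≤ m := (ENNReal.le_tsum k).trans hug
        have h2 : ENNReal.ofReal (((1 / 2 : ℝ) ^ k) ^ (-s)) *
            ENNReal.ofReal (((1 / 2 : ℝ) ^ k) ^ s) = 1 := by
          rw [← ENNReal.ofReal_mul (by positivity), ← Real.rpow_add (by positivity)]
          simp
        calc _ = ν (Metric.closedBall u ((1 / 2) ^ k)) *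
            ENNReal.ofReal (((1 / 2 : ℝ) ^ k) ^ (-s)) *
            ENNReal.ofReal (((1 / 2 : ℝ) ^ k) ^ s) := by rw [mul_assoc, h2, mul_one]
          _ ≤ _ := by gcongr; exact h1.trans le_self_add
      have h1 := measure_le_mul_ediam_rpow hs (by finiteness) hk huU hU
      rw [mul_comm, ← div_eq_mul_inv]
      refine ENNReal.div_le_of_le_mul' ((measure_mono Set.inter_subset_left).trans h1)
  have hne : μH[s] S ≠ 0 := by
    intro h0
    have h1 := hle S
    rw [h0, Measure.smul_apply, smul_eq_mul, Measure.restrict_apply' hA] at h1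
    exact (mul_ne_zero (ENNReal.inv_ne_zero.2 hCt) hm) (le_antisymm h1 bot_le)
  have h2 := le_dimH_of_hausdorffMeasure_ne_zero (d := s.toNNReal)
    (by rwa [Real.coe_toNNReal _ hs.le])
  exact h2

/-! ### The random measure and the almost sure conclusions -/

theorem SummableProd.digitSum_goldenDigit_mem {y : ℕ → ℝ} (hy : SummableProd y) (x : ℝ) :
    digitSum y (goldenDigit x) ∈ fibonacciSumSet y :=
  ⟨goldenDigit x, goldenDigit_eq_zero_or_one x, goldenDigit_mul_succ x,
    hy.hasSum_digitSum (goldenDigit_eq_zero_or_one x)⟩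

theorem measurable_digitSum_goldenDigit (y : ℕ → ℝ) :
    Measurable fun x => digitSum y (goldenDigit x) :=
  measurable_digitSum measurable_const measurable_goldenDigit_seq

theorem SummableProd.map_fibonacciSumSet_ne_zero {y : ℕ → ℝ} (hy : SummableProd y) :
    (volume.restrict (Set.Ico (0 : ℝ) 1)).map (fun x => digitSum y (goldenDigit x))
      (fibonacciSumSet y) ≠ 0 := by
  -- This inequality holds for arbitrary sets, so measurability of the sum set is not needed.
  have h := Measure.le_map_apply (μ := volume.restrict (Set.Ico (0 : ℝ) 1))
    (measurable_digitSum_goldenDigit y).aemeasurable (fibonacciSumSet y)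
  rw [Set.preimage_eq_univ_iff.2 (Set.range_subset_iff.2 hy.digitSum_goldenDigit_mem)] at h
  intro h0
  rw [h0] at h
  simp at h

theorem measurable_prod_abs_digitSum_sub_le (r : ℝ) :
    Measurable fun y => ((volume.restrict (Set.Ico (0 : ℝ) 1)).prod
      (volume.restrict (Set.Ico (0 : ℝ) 1)))
        {p | |digitSum y (goldenDigit p.1) - digitSum y (goldenDigit p.2)| ≤ r} :=
  measurable_measure_prodMk_left (measurableSet_abs_digitSum_sub_le r)

/-- Almost every sequence lies in `decaySet γ M` for some M = m + 1, as γ > 1/θ. Summability is a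
premise of `h` because membership in a set not shown measurable cannot be read off the restricted
measure. -/
theorem ae_of_forall_ae_decaySet {θ γ : ℝ} (hθ : 0 < θ) (hγ : 1 / θ < γ)
    {p : (ℕ → ℝ) → Prop}
    (h : ∀ M, 0 < M → ∀ᵐ y ∂(powerUniformSeqLaw θ).restrict (decaySet γ M),
      SummableProd y → p y) :
    ∀ᵐ y ∂powerUniformSeqLaw θ, p y := by
  have hall : ∀ᵐ y ∂powerUniformSeqLaw θ, ∀ m : ℕ, y ∈ decaySet γ (m + 1) →
      SummableProd y → p y :=
    ae_all_iff.2 fun m => ae_imp_of_ae_restrict (h (m + 1) (by positivity))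
  filter_upwards [hall, ae_isTypical hθ] with y hy hyt
  obtain ⟨C, hC, hCle⟩ := hyt.exists_le_partialProd hγ
  obtain ⟨m, hm⟩ := exists_nat_ge C
  have hs := hyt.summableProd hθ
  refine hy m ⟨hs, fun n => (hCle n).trans ?_⟩ hs
  exact mul_le_mul_of_nonneg_right (by linarith) (hyt.partialProd_pos n).le

theorem ae_volume_fibonacciSumSet_pos {θ : ℝ} (hθ : 0 < θ)
    (h : 1 / Real.log Real.goldenRatio < θ) :
    ∀ᵐ y ∂powerUniformSeqLaw θ, 0 < volume (fibonacciSumSet y) := by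
  have hlog : 0 < Real.log Real.goldenRatio := Real.log_pos Real.one_lt_goldenRatio
  obtain ⟨γ, hγ1, hγ2⟩ : ∃ γ, 1 / θ < γ ∧ γ < Real.log Real.goldenRatio :=
    exists_between ((one_div_lt hlog hθ).1 h)
  have hγ : 0 < γ := (one_div_pos.2 hθ).trans hγ1
  refine ae_of_forall_ae_decaySet hθ hγ1 fun M hM => ?_
  obtain ⟨K, hK, hKle⟩ := exists_lintegral_prod_abs_digitSum_sub_le (s := 1) hθ hM one_pos le_rfl
    hγ (by rwa [mul_one])
  set E : ℕ → (ℕ → ℝ) → ENNReal := fun k y => (2 : ENNReal) ^ k *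
    ((volume.restrict (Set.Ico (0 : ℝ) 1)).prod (volume.restrict (Set.Ico (0 : ℝ) 1)))
      {p | |digitSum y (goldenDigit p.1) - digitSum y (goldenDigit p.2)| ≤ (1 / 2) ^ k} with hE
  have hEm : ∀ k, Measurable (E k) := fun k =>
    (measurable_prod_abs_digitSum_sub_le _).const_mul _
  have hEle : ∀ k, ∫⁻ y in decaySet γ M, E k y ∂powerUniformSeqLaw θ ≤ K := by
    intro k
    rw [hE, lintegral_const_mul _ (measurable_prod_abs_digitSum_sub_le _)]
    refine (mul_le_mul_right (hKle _ (by positivity)) _).trans_eq ?_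
    rw [Real.rpow_one, mul_left_comm, ← ENNReal.ofReal_ofNat, ← ENNReal.ofReal_pow (by norm_num),
      ← ENNReal.ofReal_mul (by positivity), ← mul_pow]
    norm_num
  have hfin : ∀ᵐ y ∂(powerUniformSeqLaw θ).restrict (decaySet γ M),
      Filter.liminf (fun k => E k y) Filter.atTop < ⊤ := by
    refine ae_lt_top (Measurable.liminf hEm) (ne_top_of_le_ne_top hK ?_)
    refine (lintegral_liminf_le hEm).trans ?_
    refine (Filter.liminf_le_liminf (Filter.Eventually.of_forall hEle)).trans_eq ?_
    exact Filter.liminf_const K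
  filter_upwards [hfin] with y hy hs
  rw [pos_iff_ne_zero]
  intro h0
  refine hs.map_fibonacciSumSet_ne_zero (measure_eq_zero_of_liminf_lintegral_closedBall ?_ h0)
  simp only [hE, prod_abs_sub_le_eq_lintegral (measurable_digitSum_goldenDigit y)] at hy
  exact hy.ne

theorem ae_le_dimH_fibonacciSumSet_of_lt {θ s : ℝ} (hθ : 0 < θ)
    (h : θ * Real.log Real.goldenRatio < 1) (hs0 : 0 < s)
    (hs : s < θ * Real.log Real.goldenRatio) :
    ∀ᵐ y ∂powerUniformSeqLaw θ, ENNReal.ofReal s ≤ dimH (fibonacciSumSet y) := by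
  -- The gap t - s makes the energy series geometric, with ratio 2^(-(t-s)).
  obtain ⟨t, hst, ht⟩ := exists_between hs
  have ht0 : 0 < t := hs0.trans hst
  obtain ⟨γ, hγ1, hγ2⟩ : ∃ γ, 1 / θ < γ ∧ γ < Real.log Real.goldenRatio / t :=
    exists_between (by rw [div_lt_div_iff₀ hθ ht0]; linarith)
  have hγ : 0 < γ := (one_div_pos.2 hθ).trans hγ1
  refine ae_of_forall_ae_decaySet hθ hγ1 fun M hM => ?_
  obtain ⟨K, hK, hKle⟩ := exists_lintegral_prod_abs_digitSum_sub_le (s := t) hθ hM ht0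
    (ht.trans h).le hγ ((lt_div_iff₀ ht0).1 hγ2)
  set E : ℕ → (ℕ → ℝ) → ENNReal := fun k y =>
    ((volume.restrict (Set.Ico (0 : ℝ) 1)).prod (volume.restrict (Set.Ico (0 : ℝ) 1)))
      {p | |digitSum y (goldenDigit p.1) - digitSum y (goldenDigit p.2)| ≤ (1 / 2) ^ k} *
      ENNReal.ofReal (((1 / 2 : ℝ) ^ k) ^ (-s)) with hE
  have hEm : ∀ k, Measurable (E k) := fun k =>
    (measurable_prod_abs_digitSum_sub_le _).mul_const _
  have hEle : ∀ k, ∫⁻ y in decaySet γ M, E k y ∂powerUniformSeqLaw θ ≤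
      K * ENNReal.ofReal ((1 / 2 : ℝ) ^ (t - s)) ^ k := by
    intro k
    rw [hE, lintegral_mul_const _ (measurable_prod_abs_digitSum_sub_le _)]
    refine (mul_le_mul_left (hKle _ (by positivity)) _).trans_eq ?_
    rw [mul_assoc, ← ENNReal.ofReal_mul (by positivity), ← Real.rpow_add (by positivity),
      ← sub_eq_add_neg, ← ENNReal.ofReal_pow (by positivity), ← Real.rpow_natCast,
      ← Real.rpow_mul (by norm_num), ← Real.rpow_natCast, ← Real.rpow_mul (by norm_num),
      mul_comm (k : ℝ)]
  have hq : (1 / 2 : ℝ) ^ (t - s) < 1 :=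
    Real.rpow_lt_one (by norm_num) (by norm_num) (sub_pos.2 hst)
  have hfin : ∀ᵐ y ∂(powerUniformSeqLaw θ).restrict (decaySet γ M), ∑' k, E k y < ⊤ := by
    refine ae_lt_top (Measurable.tsum hEm) ?_
    rw [lintegral_tsum fun k => (hEm k).aemeasurable]
    refine ne_top_of_le_ne_top ?_ (ENNReal.tsum_le_tsum hEle)
    rw [ENNReal.tsum_mul_left, ENNReal.tsum_geometric]
    refine ENNReal.mul_ne_top hK (ENNReal.inv_ne_top.2 ?_)
    exact (tsub_pos_of_lt (ENNReal.ofReal_lt_one.2 hq)).ne'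
  filter_upwards [hfin] with y hy hsum
  refine le_dimH_of_lintegral_tsum_closedBall hs0 ?_ hsum.map_fibonacciSumSet_ne_zero
  rw [lintegral_tsum fun k => ((measurable_measure_closedBall _ _).mul_const _).aemeasurable]
  simp only [lintegral_mul_const _ (measurable_measure_closedBall _ _)]
  simp only [hE, prod_abs_sub_le_eq_lintegral (measurable_digitSum_goldenDigit y)] at hy
  exact hy.ne

theorem ae_dimH_fibonacciSumSet {θ : ℝ} (hθ : 0 < θ)
    (h : θ * Real.log Real.goldenRatio < 1) :
    ∀ᵐ y ∂powerUniformSeqLaw θ, dimH (fibonacciSumSet y) =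
      ENNReal.ofReal (θ * Real.log Real.goldenRatio) := by
  -- The exceptional null set depends on the exponent, so only rational exponents are used.
  have hq : ∀ᵐ y ∂powerUniformSeqLaw θ, ∀ q : ℚ, 0 < (q : ℝ) →
      (q : ℝ) < θ * Real.log Real.goldenRatio →
      ENNReal.ofReal q ≤ dimH (fibonacciSumSet y) := by
    refine ae_all_iff.2 fun q => ?_
    by_cases hq : 0 < (q : ℝ) ∧ (q : ℝ) < θ * Real.log Real.goldenRatio
    · filter_upwards [ae_le_dimH_fibonacciSumSet_of_lt hθ h hq.1 hq.2] with y hy _ _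
      exact hy
    · exact Filter.Eventually.of_forall fun y h1 h2 => absurd ⟨h1, h2⟩ hq
  filter_upwards [hq, ae_isTypical hθ] with y hy hyt
  refine le_antisymm (hyt.dimH_fibonacciSumSet_le hθ) (le_of_forall_lt fun c hc => ?_)
  have hct : c ≠ ⊤ := hc.ne_top
  rw [← ENNReal.ofReal_toReal hct, ENNReal.ofReal_lt_ofReal_iff_of_nonneg
    ENNReal.toReal_nonneg] at hc
  obtain ⟨q, hq1, hq2⟩ := exists_rat_btwn hc
  have hq0 : 0 < (q : ℝ) := ENNReal.toReal_nonneg.trans_lt hq1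
  refine lt_of_lt_of_le ?_ (hy q hq0 hq2)
  rwa [← ENNReal.ofReal_toReal hct, ENNReal.ofReal_lt_ofReal_iff hq0]

theorem proposition1p3 {Ω : Type*} [MeasurableSpace Ω] (P : Measure Ω) [IsProbabilityMeasure P]
    (θ : ℝ) (hθ : 0 < θ) (Y : ℕ → Ω → ℝ)
    (hlaw : ∀ i, HasLaw (Y i) (powerUniformLaw θ) P) (hindep : iIndepFun Y P) :
    (1 / Real.log Real.goldenRatio < θ →
      ∀ᵐ ω ∂P, 0 < volume (fibonacciSumSet (fun i => Y i ω))) ∧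
    (θ < 1 / Real.log Real.goldenRatio →
      ∀ᵐ ω ∂P, volume (fibonacciSumSet (fun i => Y i ω)) = 0 ∧
        dimH (fibonacciSumSet (fun i => Y i ω)) =
          ENNReal.ofReal (θ * Real.log Real.goldenRatio)) := by
  have hL : HasLaw (fun ω i => Y i ω) (powerUniformSeqLaw θ) P :=
    hindep.hasLaw_infinitePi hlaw (by fun_prop)
  have transfer : ∀ {p : (ℕ → ℝ) → Prop}, (∀ᵐ y ∂powerUniformSeqLaw θ, p y) →
      ∀ᵐ ω ∂P, p fun i => Y i ω := fun {p} hp => by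
    rw [← hL.map_eq] at hp
    exact ae_of_ae_map hL.aemeasurable hp
  have hlog : 0 < Real.log Real.goldenRatio := Real.log_pos Real.one_lt_goldenRatio
  refine ⟨fun h => transfer (ae_volume_fibonacciSumSet_pos hθ h), fun h => ?_⟩
  have h' : θ * Real.log Real.goldenRatio < 1 := (lt_div_iff₀ hlog).1 h
  refine transfer (p := fun y => volume (fibonacciSumSet y) = 0 ∧ dimH (fibonacciSumSet y) =
    ENNReal.ofReal (θ * Real.log Real.goldenRatio)) ?_
  filter_upwards [ae_isTypical hθ, ae_dimH_fibonacciSumSet hθ h'] with y hy hd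
  refine ⟨?_, hd⟩
  rw [← hausdorffMeasure_real]
  exact hy.hausdorffMeasure_fibonacciSumSet hθ h'
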